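/- Let $(X,\rho)$ be a metric space (not necessarily separable or complete) with its Borel $\sigma$-algebra, let $B_b(X)$ and $C_b(X)$ be the spaces of bounded Borel measurable, respectively bounded continuous, real functions on $X$, and let $\mathcal M_1(X)$ be the set of Borel probability measures on $X$. Let $(P_t)_{t\ge 0}$ be a stochastically continuous Feller semigroup on $B_b(X)$, that is: the $P_t:B_b(X)\to B_b(X)$ are linear, $P_0=\mathrm{Id}$ and $P_{s+t}=P_sP_t$; $P_t\mathbf 1_X=\mathbf 1_X$, and $P_t\varphi\ge 0$ whenever $\varphi\ge 0$; $P_t(C_b(X))\subset C_b(X)$; there is a semigroup $P_t^*:\mathcal M_1(X)\to\mathcal M_1(X)$ with $\int P_t\varphi\,d\mu=\int\varphi\,d(P_t^*\mu)$ for all $\varphi\in B_b(X)$, $\mu\in\mathcal M_1(X)$, $t\ge0$; and $\lim_{t\to0^+}P_t\psi(x)=\psi(x)$ for all $\psi\in C_b(X)$, $x\in X$. Assume that there exists $z\in X$ such that $$\liminf_{t\to\infty}\frac1t\int_0^tP_s^*\delta_z(B(z,\varepsilon))\,ds>0\qquad\text{for every }\varepsilon>0,$$ where $B(z,\varepsilon)$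 is the open ball, and that the family $(P_t\varphi)_{t\ge0}$ is equicontinuous at $z$ for every $\varphi\in C_b(X)$. Then $(P_t)_{t\ge0}$ has an invariant probability measure, i.e. there is $\mu_*\in\mathcal M_1(X)$ with $P_t^*\mu_*=\mu_*$ for all $t\ge0$. Moreover, $\mu_*$ can be chosen so that the averages $Q_n\delta_z=\frac1n\int_0^nP_s^*\delta_z\,ds$ converge weakly to $\mu_*$ as $n\to\infty$ through the positive integers. -/

import Mathlib

open MeasureTheory Filter Topology
open scoped NNReal ENNReal

/-- The space `B_b(X)` of bounded measurable real functions on `X`. -/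
def BoundedMeasurable (X : Type*) [MeasurableSpace X] : Submodule ℝ (X → ℝ) where
  carrier := {f | Measurable f ∧ ∃ C : ℝ, ∀ x, |f x| ≤ C}
  zero_mem' := ⟨measurable_const, 0, fun x => by simp⟩
  add_mem' := by
    rintro f g ⟨hf, C, hC⟩ ⟨hg, D, hD⟩
    exact ⟨hf.add hg, C + D, fun x => (abs_add_le _ _).trans (add_le_add (hC x) (hD x))⟩
  smul_mem' := by
    rintro c f ⟨hf, C, hC⟩
    refine ⟨hf.const_smul c, |c| * C, fun x => ?_⟩
    simp only [Pi.smul_apply, smul_eq_mul, abs_mul]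
    exact mul_le_mul_of_nonneg_left (hC x) (abs_nonneg c)

/-- The constant function `1`, as an element of `B_b(X)`. -/
def BoundedMeasurable.one (X : Type*) [MeasurableSpace X] : BoundedMeasurable X :=
  ⟨fun _ => 1, measurable_const, 1, fun _ => by simp⟩

/-- A Markov semigroup `(P_t)_{t ≥ 0}` of linear operators on `B_b(X)`. -/
structure MarkovSemigroup (X : Type*) [MeasurableSpace X] where
  /-- the operators `P_t` -/
  P : ℝ≥0 → BoundedMeasurable X →ₗ[ℝ] BoundedMeasurable X
  P_zero : P 0 = LinearMap.id
  P_add : ∀ s t, P (s + t) = P s ∘ₗ P t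
  P_one : ∀ t, P t (BoundedMeasurable.one X) = BoundedMeasurable.one X
  P_nonneg : ∀ t (φ : BoundedMeasurable X),
    (∀ x, 0 ≤ (φ : X → ℝ) x) → ∀ x, 0 ≤ (P t φ : X → ℝ) x

/-- A stochastically continuous Feller semigroup: a Markov semigroup preserving `C_b(X)`, with a
dual semigroup `(P_t^*)` on Borel probability measures, `⟨P_t φ, μ⟩ = ⟨φ, P_t^* μ⟩`, and such that
`P_t ψ (x) → ψ x` as `t → 0+`. An element of `C_b(X)` is a continuous element of `B_b(X)`. -/
structure FellerSemigroup (X : Type*) [TopologicalSpace X] [MeasurableSpace X]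
    [BorelSpace X] extends MarkovSemigroup X where
  feller : ∀ t (φ : BoundedMeasurable X), Continuous (φ : X → ℝ) → Continuous (P t φ : X → ℝ)
  /-- the dual operators `P_t^*` -/
  dual : ℝ≥0 → ProbabilityMeasure X → ProbabilityMeasure X
  dual_zero : ∀ μ, dual 0 μ = μ
  dual_add : ∀ s t μ, dual (s + t) μ = dual s (dual t μ)
  duality : ∀ t (φ : BoundedMeasurable X) (μ : ProbabilityMeasure X),
    ∫ x, (P t φ : X → ℝ) x ∂(μ : Measure X) = ∫ x, (φ : X → ℝ) x ∂(dual t μ : Measure X)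
  stoch_cont : ∀ ψ : BoundedMeasurable X, Continuous (ψ : X → ℝ) → ∀ x,
    Tendsto (fun t : ℝ≥0 => (P t ψ : X → ℝ) x) (𝓝[>] 0) (𝓝 ((ψ : X → ℝ) x))

theorem MarkovSemigroup.abs_apply_le {X : Type*} [MeasurableSpace X] (S : MarkovSemigroup X)
    (t : ℝ≥0) (φ : BoundedMeasurable X) (C : ℝ) (hC : ∀ x, |(φ : X → ℝ) x| ≤ C) (x : X) :
    |(S.P t φ : X → ℝ) x| ≤ C := by
  have h1 := S.P_nonneg t (C • BoundedMeasurable.one X - φ) (fun y => by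
    have := (abs_le.1 (hC y)).2
    simp [BoundedMeasurable.one]; linarith) x
  have h2 := S.P_nonneg t (C • BoundedMeasurable.one X + φ) (fun y => by
    have := (abs_le.1 (hC y)).1
    simp [BoundedMeasurable.one]; linarith) x
  rw [map_sub, map_smul, S.P_one] at h1
  rw [map_add, map_smul, S.P_one] at h2
  simp [BoundedMeasurable.one] at h1 h2
  exact abs_le.2 ⟨by linarith, h1⟩

namespace FellerSemigroup

theorem measurable_pairing {X : Type*} [TopologicalSpace X] [MeasurableSpace X]
    [BorelSpace X] (S : FellerSemigroup X) (μ : ProbabilityMeasure X) (ψ : BoundedMeasurable X)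
    (hψ : Continuous (ψ : X → ℝ)) :
    Measurable (fun s : ℝ≥0 => ∫ x, (ψ : X → ℝ) x ∂(S.dual s μ : Measure X)) := by
  set f := fun s : ℝ≥0 => ∫ x, (ψ : X → ℝ) x ∂(S.dual s μ : Measure X) with hf
  have hright : ∀ (s : ℝ≥0) (h : ℕ → ℝ≥0), Tendsto h atTop (𝓝[>] 0) →
      Tendsto (fun n => f (s + h n)) atTop (𝓝 (f s)) := by
    intro s h hh
    have e : ∀ n, f (s + h n) =
        ∫ x, (S.P (h n) ψ : X → ℝ) x ∂(S.dual s μ : Measure X) := by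
      intro n
      rw [S.duality, ← S.dual_add, add_comm (h n) s]
    simp only [e]
    obtain ⟨C, hC⟩ := ψ.2.2
    refine tendsto_integral_of_dominated_convergence (fun _ => C) ?_ ?_ ?_ ?_
    · exact fun n => (S.P (h n) ψ).2.1.aestronglyMeasurable
    · exact integrable_const _
    · exact fun n => ae_of_all _ fun x => S.abs_apply_le (h n) ψ C hC x
    · exact ae_of_all _ fun x => (S.stoch_cont ψ hψ x).comp hh
  let a : ℕ → ℝ≥0 → ℝ≥0 := fun n s => ((⌊((n : ℝ≥0) + 1) * s⌋₊ : ℝ≥0) + 1) / ((n : ℝ≥0) + 1)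
  refine measurable_of_tendsto_metrizable (f := fun n s => f (a n s)) ?_ ?_
  · intro n
    have : Measurable (fun k : ℕ => f (((k : ℝ≥0) + 1) / ((n : ℝ≥0) + 1))) := measurable_from_nat
    exact this.comp (Nat.measurable_floor.comp (measurable_const.mul measurable_id))
  · rw [tendsto_pi_nhds]
    intro s
    have hpos : ∀ n : ℕ, (0 : ℝ≥0) < (n : ℝ≥0) + 1 := fun n => by positivity
    have hlt : ∀ n, s < a n s := by
      intro n
      rw [lt_div_iff₀ (hpos n), mul_comm]
      exact Nat.lt_floor_add_one _
    have hle : ∀ n, a n s ≤ s + 1 / ((n : ℝ≥0) + 1) := by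
      intro n
      rw [div_le_iff₀ (hpos n), add_mul s, one_div, inv_mul_cancel₀ (hpos n).ne', mul_comm s]
      gcongr
      exact Nat.floor_le (by positivity)
    have hlim : Tendsto (fun n => a n s - s) atTop (𝓝[>] 0) := by
      refine tendsto_nhdsWithin_iff.2 ⟨?_, Eventually.of_forall fun n => tsub_pos_of_lt (hlt n)⟩
      refine tendsto_of_tendsto_of_tendsto_of_le_of_le tendsto_const_nhds
        (tendsto_one_div_add_atTop_nhds_zero_nat (𝕜 := ℝ≥0)) (fun _ => zero_le) fun n => ?_
      rw [tsub_le_iff_left]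
      exact hle n
    have := hright s _ hlim
    refine this.congr fun n => ?_
    rw [add_tsub_cancel_of_le (hlt n).le]

theorem measurable_dual {X : Type*} [MetricSpace X] [MeasurableSpace X] [BorelSpace X]
    (S : FellerSemigroup X) (μ : ProbabilityMeasure X) :
    Measurable (fun s : ℝ≥0 => (S.dual s μ : Measure X)) := by
  refine Measurable.measure_of_isPiSystem_of_isProbabilityMeasure
    (BorelSpace.measurable_eq.trans borel_eq_generateFrom_isClosed) isPiSystem_isClosed ?_
  intro F hF
  have hF : IsClosed F := hF
  have key : Measurable (fun s : ℝ≥0 => (S.dual s μ : Measure X).real F) := by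
    have hδ : ∀ n : ℕ, 0 < 1 / ((n : ℝ) + 1) := fun n => by positivity
    refine measurable_of_tendsto_metrizable
      (f := fun (n : ℕ) (s : ℝ≥0) =>
        ∫ x, (thickenedIndicator (hδ n) F x : ℝ) ∂(S.dual s μ : Measure X)) ?_ ?_
    · intro n
      have hc : Continuous (fun x => (thickenedIndicator (hδ n) F x : ℝ)) :=
        NNReal.continuous_coe.comp (thickenedIndicator (hδ n) F).continuous
      exact S.measurable_pairing μ ⟨fun x => (thickenedIndicator (hδ n) F x : ℝ),
        hc.measurable, 1, fun x => by
          rw [abs_of_nonneg (NNReal.coe_nonneg _)]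
          exact_mod_cast thickenedIndicator_le_one (hδ n) F x⟩ hc
    · rw [tendsto_pi_nhds]
      intro s
      exact tendsto_integral_thickenedIndicator_of_isClosed _ hF hδ
        tendsto_one_div_add_atTop_nhds_zero_nat
  have h2 := key.ennreal_ofReal
  simpa [Measure.real] using h2

theorem measurable_dual_toNNReal {X : Type*} [MetricSpace X] [MeasurableSpace X] [BorelSpace X]
    (S : FellerSemigroup X) (μ : ProbabilityMeasure X) :
    Measurable (fun s : ℝ => (S.dual s.toNNReal μ : Measure X)) :=
  (S.measurable_dual μ).comp measurable_real_toNNReal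

/-- The time average `Q_t μ = t⁻¹ ∫_0^t P_s^* μ ds` for `t > 0`, a Borel probability measure. -/
noncomputable def timeAverage {X : Type*} [MetricSpace X] [MeasurableSpace X] [BorelSpace X]
    (S : FellerSemigroup X) (t : ℝ) (ht : 0 < t) (μ : ProbabilityMeasure X) :
    ProbabilityMeasure X :=
  ⟨(ENNReal.ofReal t)⁻¹ • Measure.bind (volume.restrict (Set.Ioc 0 t))
      (fun s : ℝ => (S.dual s.toNNReal μ : Measure X)), by
    constructor
    rw [Measure.smul_apply, Measure.bind_apply MeasurableSet.univ
      (S.measurable_dual_toNNReal μ).aemeasurable]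
    simp [ENNReal.inv_mul_cancel, ht]⟩

/-- `Q_t μ (A) = t⁻¹ ∫_0^t P_s^* μ (A) ds` for every Borel set `A`. -/
theorem timeAverage_apply {X : Type*} [MetricSpace X] [MeasurableSpace X] [BorelSpace X]
    (S : FellerSemigroup X) (t : ℝ) (ht : 0 < t) (μ : ProbabilityMeasure X) (A : Set X)
    (hA : MeasurableSet A) :
    (S.timeAverage t ht μ A : ℝ) = 1 / t * ∫ s in (0 : ℝ)..t, (S.dual s.toNNReal μ A : ℝ) := by
  have hm := (Measure.measurable_coe hA).comp (S.measurable_dual_toNNReal μ)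
  have h1 : (S.timeAverage t ht μ A : ℝ) = ((S.timeAverage t ht μ : Measure X) A).toReal := rfl
  have h2 : (S.timeAverage t ht μ : Measure X) A = (ENNReal.ofReal t)⁻¹ *
      ∫⁻ s in Set.Ioc 0 t, (S.dual s.toNNReal μ : Measure X) A := by
    simp only [timeAverage, ProbabilityMeasure.coe_mk, Measure.smul_apply, smul_eq_mul]
    rw [Measure.bind_apply hA (S.measurable_dual_toNNReal μ).aemeasurable]
  rw [h1, h2, intervalIntegral.integral_of_le ht.le, ENNReal.toReal_mul, ENNReal.toReal_inv,
    ENNReal.toReal_ofReal ht.le, one_div]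
  congr 1
  exact (integral_toReal hm.aemeasurable (ae_of_all _ fun s => measure_lt_top _ _)).symm

/-- `μ` is invariant for `(P_t)` if `P_t^* μ = μ` for all `t ≥ 0`. -/
def IsInvariant {X : Type*} [TopologicalSpace X] [MeasurableSpace X] [BorelSpace X]
    (S : FellerSemigroup X) (μ : ProbabilityMeasure X) : Prop :=
  ∀ t : ℝ≥0, S.dual t μ = μ

end FellerSemigroup

/-! The averages `Q_n δ_z` are shown to be weakly Cauchy. Alexandrov's theorem then gives a weak
limit without separability, completeness or tightness, and the limit is invariant because the
averages are asymptotically invariant and `P_t` preserves `C_b(X)`.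

For the Cauchy property, let `Λ` be an ultrafilter limit of the functionals `f ↦ ∫ f dQ_n δ_z` on
`C_b(X)`. It is positive and `P_1`-invariant, though perhaps only finitely additive. By Jensen,
`P_1` contracts the semidefinite form `Λ(gh)`, so the mean ergodic theorem makes the averages `A_n
f` of `P_1^k f` Cauchy in the seminorm of that form. Equicontinuity spreads a gap between `A_m f`
and `A_n f` at `z` over a whole ball, and the recurrence hypothesis gives bumps at `z` positive
`Λ`-mass; hence `A_n f(z)` is Cauchy (`cauchySeq_birkhoffAverage_onBCF`). Applying this to `P_s f`
and integrating over `s ∈ [0,1]` recovers the continuous time averages.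

Alexandrov's theorem rests on `σ`-smoothness in the limit, which comes from Baire's theorem on the
Cantor space (`exists_integral_le_of_locally_zero`). It makes a limit content on open sets countably
subadditive; the induced outer measure is metric, so it restricts to a Borel measure. -/

/-- A sequence of probability measures is weakly Cauchy if the integrals of every bounded continuous
function form a Cauchy sequence. -/
def WeaklyCauchy {X : Type*} [TopologicalSpace X] [MeasurableSpace X]
    (μ : ℕ → ProbabilityMeasure X) : Prop :=
  ∀ f : X → ℝ, Continuous f → (∃ C, ∀ x, |f x| ≤ C) →
    CauchySeq fun n => ∫ x, f x ∂(μ n : Measure X)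

/-! ### `σ`-smoothness of weakly Cauchy sequences. -/

namespace WeaklyCauchy

/-- `σ`-smoothness for sequences that vanish locally from some index on. -/
theorem exists_integral_le_of_locally_zero {X : Type*} [TopologicalSpace X] [MeasurableSpace X]
    [BorelSpace X] {μ : ℕ → ProbabilityMeasure X} (hμ : WeaklyCauchy μ) (g : ℕ → X → ℝ)
    (hc : ∀ k, Continuous (g k)) (hanti : ∀ x, Antitone fun k => g k x) {C : ℝ}
    (hC : ∀ x, g 0 x ≤ C) (hloc : ∀ x, ∃ M, ∀ᶠ y in 𝓝 x, ∀ k, M ≤ k → g k y = 0)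
    {ε : ℝ} (hε : 0 < ε) :
    ∃ K N, ∀ n, N ≤ n → ∫ x, g K x ∂(μ n : Measure X) ≤ ε := by
  let b : Bool → ℝ := fun i => if i then 1 else 0
  have hb0 : ∀ i, 0 ≤ b i := fun i => by cases i <;> simp [b]
  have hb1 : ∀ i, b i ≤ 1 := fun i => by cases i <;> simp [b]
  -- The digits of `c` select increments of the telescoping series of `g 0`. Near each point only
  -- finitely many terms survive, so `F c` is continuous and the weak Cauchy property applies to it.
  let F : (ℕ → Bool) → X → ℝ := fun c x => ∑' k, b (c k) * (g k x - g (k + 1) x)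
  have hpt : ∀ x, ∃ M, ∀ k, M ≤ k → g k x = 0 := fun x =>
    (hloc x).imp fun M h => h.self_of_nhds
  have hg0 : ∀ k x, 0 ≤ g k x := fun k x => by
    obtain ⟨M, hM⟩ := hpt x
    rw [← hM (max k M) (le_max_right _ _)]
    exact hanti x (le_max_left _ _)
  have hsum : ∀ c x M, (∀ k, M ≤ k → g k x = 0) →
      F c x = ∑ k ∈ Finset.range M, b (c k) * (g k x - g (k + 1) x) := by
    intro c x M hM
    refine tsum_eq_sum fun k hk => ?_
    have : M ≤ k := by simpa using hk
    rw [hM k this, hM (k + 1) (by omega)]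
    simp
  have hFc : ∀ c, Continuous (F c) := by
    intro c
    refine continuous_iff_continuousAt.2 fun x => ?_
    obtain ⟨M, hM⟩ := hloc x
    have hcont : Continuous fun y =>
        ∑ k ∈ Finset.range M, b (c k) * (g k y - g (k + 1) y) :=
      continuous_finsetSum _ fun k _ => continuous_const.mul ((hc k).sub (hc (k + 1)))
    refine hcont.continuousAt.congr ?_
    filter_upwards [hM] with y hy using (hsum c y M hy).symm
  have hFx : ∀ x, Continuous fun c => F c x := by
    intro x
    obtain ⟨M, hM⟩ := hpt x
    simp only [fun c => hsum c x M hM]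
    refine continuous_finsetSum _ fun k _ => Continuous.mul ?_ continuous_const
    exact (continuous_of_discreteTopology (f := b)).comp (continuous_apply k)
  have hFb : ∀ c x, |F c x| ≤ C := by
    intro c x
    obtain ⟨M, hM⟩ := hpt x
    have hd : ∀ k, 0 ≤ g k x - g (k + 1) x := fun k => sub_nonneg.2 (hanti x (Nat.le_succ k))
    rw [hsum c x M hM, abs_of_nonneg (Finset.sum_nonneg fun k _ => mul_nonneg (hb0 _) (hd k))]
    calc _ ≤ ∑ k ∈ Finset.range M, (g k x - g (k + 1) x) :=
          Finset.sum_le_sum fun k _ => mul_le_of_le_one_left (hd k) (hb1 _)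
      _ = g 0 x - g M x := Finset.sum_range_sub' (fun k => g k x) M
      _ ≤ C := by linarith [hC x, hg0 M x]
  have hI : ∀ n, Continuous fun c => ∫ x, F c x ∂(μ n : Measure X) := fun n =>
    continuous_of_dominated (bound := fun _ => C)
      (fun c => (hFc c).measurable.aestronglyMeasurable)
      (fun c => ae_of_all _ fun x => hFb c x) (integrable_const _) (ae_of_all _ hFx)
  have hint : ∀ c n, Integrable (F c) (μ n : Measure X) := fun c n =>
    Integrable.of_bound (hFc c).measurable.aestronglyMeasurable C (ae_of_all _ fun x => hFb c x)
  -- Baire's theorem makes the index `N` uniform in `c` over some cylinder.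
  let A : ℕ → Set (ℕ → Bool) := fun N => {c | ∀ n, N ≤ n → ∀ m, N ≤ m →
    |∫ x, F c x ∂(μ n : Measure X) - ∫ x, F c x ∂(μ m : Measure X)| ≤ ε / 3}
  have hAc : ∀ N, IsClosed (A N) := by
    intro N
    simp only [A, Set.ofPred_forall]
    exact isClosed_iInter fun n => isClosed_iInter fun _ => isClosed_iInter fun m =>
      isClosed_iInter fun _ => isClosed_le ((hI n).sub (hI m)).abs continuous_const
  have hAU : ⋃ N, A N = Set.univ := by
    refine Set.eq_univ_of_forall fun c => ?_
    obtain ⟨N, hN⟩ := Metric.cauchySeq_iff.1 (hμ (F c) (hFc c) ⟨C, hFb c⟩) (ε / 3) (by positivity)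
    exact Set.mem_iUnion.2 ⟨N, fun n hn m hm => (hN n hn m hm).le⟩
  obtain ⟨N, c, hcN⟩ := nonempty_interior_of_iUnion_of_closed hAc hAU
  obtain ⟨I, u, hu, hsub⟩ := isOpen_pi_iff.1 (isOpen_interior (s := A N)) c hcN
  obtain ⟨K, hK⟩ := I.exists_nat_subset_range
  -- Both sequences agree with `c` below `K`, hence lie in `A N`, once `L ≥ K`; switching on all
  -- digits from `L` on adds exactly `g L`.
  let c0 : ℕ → Bool := fun k => if k < K then c k else false
  let c1 : ℕ → ℕ → Bool := fun L k => if k < L then c0 k else true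
  have hmem : ∀ d : ℕ → Bool, (∀ k, k < K → d k = c k) → d ∈ A N := by
    intro d hd
    refine interior_subset (hsub fun k hk => ?_)
    rw [hd k (Finset.mem_range.1 (hK hk))]
    exact (hu k hk).2
  have hdiff : ∀ L, K ≤ L → ∀ x, F (c1 L) x - F c0 x = g L x := by
    intro L hL x
    obtain ⟨M, hM⟩ := hpt x
    -- Cutting at `L + M` instead of `M` lets the sums split at `L`.
    have hM' : ∀ k, L + M ≤ k → g k x = 0 := fun k hk => hM k (by omega)
    rw [hsum _ x _ hM', hsum _ x _ hM', Finset.sum_range_add, Finset.sum_range_add]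
    have h1 : ∑ k ∈ Finset.range L, b (c1 L k) * (g k x - g (k + 1) x) =
        ∑ k ∈ Finset.range L, b (c0 k) * (g k x - g (k + 1) x) :=
      Finset.sum_congr rfl fun k hk => by simp [c1, Finset.mem_range.1 hk]
    have h2 : ∑ k ∈ Finset.range M, b (c0 (L + k)) * (g (L + k) x - g (L + k + 1) x) = 0 :=
      Finset.sum_eq_zero fun k _ => by simp [c0, b, show ¬ L + k < K by omega]
    have h3 : ∑ k ∈ Finset.range M, b (c1 L (L + k)) * (g (L + k) x - g (L + k + 1) x) =
        g L x - g (L + M) x := by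
      refine Eq.trans ?_ (Finset.sum_range_sub' (fun k => g (L + k) x) M)
      exact Finset.sum_congr rfl fun k _ => by simp [c1, b, add_assoc]
    rw [h1, h2, h3, hM' (L + M) le_rfl]
    ring
  have hlim : Tendsto (fun L => ∫ x, g L x ∂(μ N : Measure X)) atTop (𝓝 0) := by
    have := tendsto_integral_of_dominated_convergence (μ := (μ N : Measure X)) (F := g)
      (f := fun _ => 0) (fun _ => C) (fun L => (hc L).measurable.aestronglyMeasurable)
      (integrable_const _) (fun L => ae_of_all _ fun x => by
        rw [Real.norm_eq_abs, abs_of_nonneg (hg0 L x)]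
        exact (hanti x (Nat.zero_le L)).trans (hC x))
      (ae_of_all _ fun x => by
        obtain ⟨M, hM⟩ := hpt x
        exact tendsto_const_nhds.congr' (eventually_atTop.2 ⟨M, fun k hk => (hM k hk).symm⟩))
    simpa using this
  obtain ⟨L, hLK, hL⟩ := ((eventually_ge_atTop K).and
    (hlim.eventually (gt_mem_nhds (show 0 < ε / 3 by positivity)))).exists
  refine ⟨L, N, fun n hn => ?_⟩
  have e : ∀ m, ∫ x, g L x ∂(μ m : Measure X) =
      ∫ x, F (c1 L) x ∂(μ m : Measure X) - ∫ x, F c0 x ∂(μ m : Measure X) := fun m => by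
    rw [← integral_sub (hint _ _) (hint _ _)]
    simp only [hdiff L hLK]
  -- Passing from `μ N` to `μ n` costs `ε / 3` for each of the two selections, and `∫ g L` against
  -- `μ N` is below `ε / 3`.
  have h0 := hmem c0 (fun k hk => by simp [c0, hk]) n hn N le_rfl
  have h1 := hmem (c1 L) (fun k hk => by simp [c1, c0, hk, hk.trans_le hLK]) n hn N le_rfl
  have hN := e N
  rw [e n]
  rw [abs_le] at h0 h1
  linarith [h0.1, h1.2]

/-- A weakly Cauchy sequence is `σ`-smooth in the limit. -/
theorem exists_integral_le_of_antitone {X : Type*} [TopologicalSpace X] [MeasurableSpace X]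
    [BorelSpace X] {μ : ℕ → ProbabilityMeasure X} (hμ : WeaklyCauchy μ) (g : ℕ → X → ℝ)
    (hc : ∀ k, Continuous (g k)) (hanti : ∀ x, Antitone fun k => g k x) {C : ℝ}
    (hC : ∀ x, g 0 x ≤ C) (hlim : ∀ x, Tendsto (fun k => g k x) atTop (𝓝 0))
    {ε : ℝ} (hε : 0 < ε) :
    ∃ K N, ∀ n, N ≤ n → ∫ x, g K x ∂(μ n : Measure X) ≤ ε := by
  have hg0 : ∀ k x, 0 ≤ g k x := fun k x => (hanti x).le_of_tendsto (hlim x) k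
  -- Truncating at `ε / 2` turns pointwise convergence into local vanishing: `g M < ε / 2` is an
  -- open condition and persists for `k ≥ M`.
  obtain ⟨K, N, h⟩ := hμ.exists_integral_le_of_locally_zero
    (fun k x => max (g k x - ε / 2) 0) (fun k => ((hc k).sub continuous_const).max continuous_const)
    (fun x k l hkl => max_le_max_right _ (sub_le_sub_right (hanti x hkl) _)) (C := C)
    (fun x => max_le (by linarith [hC x]) ((hg0 0 x).trans (hC x)))
    (fun x => by
      obtain ⟨M, hM⟩ := ((hlim x).eventually (gt_mem_nhds (half_pos hε))).exists
      refine ⟨M, ?_⟩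
      filter_upwards [(hc M).continuousAt.eventually (gt_mem_nhds hM)] with y hy k hk
      exact max_eq_right (by linarith [hanti y hk]))
    (half_pos hε)
  refine ⟨K, N, fun n hn => ?_⟩
  have hbd : ∀ x, |g K x| ≤ C := fun x => by
    rw [abs_of_nonneg (hg0 K x)]
    exact (hanti x (Nat.zero_le K)).trans (hC x)
  have hi : Integrable (fun x => max (g K x - ε / 2) 0) (μ n : Measure X) := by
    refine Integrable.of_bound (((hc K).sub continuous_const).max
      continuous_const).measurable.aestronglyMeasurable C (ae_of_all _ fun x => ?_)
    rw [Real.norm_eq_abs, abs_of_nonneg (le_max_right _ _)]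
    exact max_le (by linarith [(abs_le.1 (hbd x)).2]) ((abs_nonneg _).trans (hbd x))
  calc ∫ x, g K x ∂(μ n : Measure X)
      ≤ ∫ x, (max (g K x - ε / 2) 0 + ε / 2) ∂(μ n : Measure X) := by
        refine integral_mono (Integrable.of_bound (hc K).measurable.aestronglyMeasurable C
          (ae_of_all _ hbd)) (hi.add (integrable_const _)) fun x => ?_
        have := le_max_left (g K x - ε / 2) 0
        simp only
        linarith
    _ = ∫ x, max (g K x - ε / 2) 0 ∂(μ n : Measure X) + ε / 2 := by
        rw [integral_add hi (integrable_const _)]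
        simp
    _ ≤ ε := by linarith [h n hn]

end WeaklyCauchy

/-! ### The limit content on open sets. -/

/-- The limit of the integrals of a nonnegative function along a sequence of measures. -/
noncomputable def limitIntegral {X : Type*} [MeasurableSpace X]
    (μ : ℕ → ProbabilityMeasure X) (f : X → ℝ≥0) : ℝ≥0∞ :=
  liminf (fun n => ∫⁻ x, f x ∂(μ n : Measure X)) atTop

theorem limitIntegral_mono {X : Type*} [MeasurableSpace X]
    (μ : ℕ → ProbabilityMeasure X) {f g : X → ℝ≥0} (h : ∀ x, f x ≤ g x) :
    limitIntegral μ f ≤ limitIntegral μ g :=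
  liminf_le_liminf (Eventually.of_forall fun n => lintegral_mono fun x =>
    ENNReal.coe_le_coe.2 (h x))

/-- The limit content of an open set `G`: the supremum of the limit integrals of continuous
functions `0 ≤ f ≤ 1_G`. -/
noncomputable def limitContent {X : Type*} [TopologicalSpace X] [MeasurableSpace X]
    (μ : ℕ → ProbabilityMeasure X) (G : Set X) : ℝ≥0∞ :=
  ⨆ f : {f : X → ℝ≥0 // Continuous f ∧ ∀ x, f x ≤ G.indicator 1 x}, limitIntegral μ f

theorem limitContent_empty {X : Type*} [TopologicalSpace X] [MeasurableSpace X]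
    (μ : ℕ → ProbabilityMeasure X) : limitContent μ ∅ = 0 := by
  refine le_antisymm (iSup_le fun f => ?_) bot_le
  have : ∀ x, f.1 x = 0 := fun x => by simpa using f.2.2 x
  simp [limitIntegral, this]

theorem limitContent_mono {X : Type*} [TopologicalSpace X] [MeasurableSpace X]
    (μ : ℕ → ProbabilityMeasure X) {G H : Set X} (h : G ⊆ H) :
    limitContent μ G ≤ limitContent μ H :=
  iSup_le fun f => le_iSup_of_le ⟨f.1, f.2.1, fun x => (f.2.2 x).trans
    (Set.indicator_le_indicator_of_subset h (fun _ => zero_le) x)⟩ le_rfl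

theorem limitContent_univ {X : Type*} [TopologicalSpace X] [MeasurableSpace X]
    (μ : ℕ → ProbabilityMeasure X) : limitContent μ Set.univ = 1 := by
  have h1 : limitIntegral μ (fun _ => 1) = 1 := by simp [limitIntegral]
  refine le_antisymm (iSup_le fun f => ?_) ?_
  · rw [← h1]
    exact limitIntegral_mono μ fun x => by simpa using f.2.2 x
  · rw [← h1]
    exact le_iSup_of_le ⟨fun _ => 1, continuous_const, fun x => by simp⟩ le_rfl

theorem limitContent_le_liminf {X : Type*} [TopologicalSpace X] [MeasurableSpace X]
    [BorelSpace X] (μ : ℕ → ProbabilityMeasure X) {G : Set X} (hG : IsOpen G) :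
    limitContent μ G ≤ liminf (fun n => (μ n : Measure X) G) atTop := by
  refine iSup_le fun f => liminf_le_liminf (Eventually.of_forall fun n => ?_)
  rw [← lintegral_indicator_one hG.measurableSet]
  refine lintegral_mono fun x => ?_
  have := f.2.2 x
  by_cases hx : x ∈ G <;> simp_all

/-! ### Alexandrov's theorem. -/

namespace WeaklyCauchy

/-- The `liminf` defining `limitIntegral` is a genuine limit here, which is what makes it additive.
-/
theorem tendsto_lintegral {X : Type*} [TopologicalSpace X] [MeasurableSpace X]
    [BorelSpace X] {μ : ℕ → ProbabilityMeasure X} (hμ : WeaklyCauchy μ) {f : X → ℝ≥0}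
    (hf : Continuous f) {C : ℝ≥0} (hC : ∀ x, f x ≤ C) :
    Tendsto (fun n => ∫⁻ x, f x ∂(μ n : Measure X)) atTop (𝓝 (limitIntegral μ f)) := by
  have hc : Continuous fun x => (f x : ℝ) := NNReal.continuous_coe.comp hf
  have hb : ∀ x, |(f x : ℝ)| ≤ C := fun x => by
    rw [NNReal.abs_eq]
    exact_mod_cast hC x
  obtain ⟨l, hl⟩ := cauchySeq_tendsto_of_complete (hμ _ hc ⟨C, hb⟩)
  have h2 : Tendsto (fun n => ∫⁻ x, f x ∂(μ n : Measure X)) atTop (𝓝 (ENNReal.ofReal l)) := by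
    refine (ENNReal.tendsto_ofReal hl).congr fun n => ?_
    exact (lintegral_coe_eq_integral _ (Integrable.of_bound hc.measurable.aestronglyMeasurable C
      (ae_of_all _ hb))).symm
  rwa [limitIntegral, h2.liminf_eq]

theorem limitIntegral_add {X : Type*} [TopologicalSpace X] [MeasurableSpace X]
    [BorelSpace X] {μ : ℕ → ProbabilityMeasure X} (hμ : WeaklyCauchy μ) {f g : X → ℝ≥0}
    (hf : Continuous f) (hg : Continuous g) {C D : ℝ≥0} (hC : ∀ x, f x ≤ C) (hD : ∀ x, g x ≤ D) :
    limitIntegral μ (fun x => f x + g x) = limitIntegral μ f + limitIntegral μ g := by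
  refine tendsto_nhds_unique (hμ.tendsto_lintegral (hf.add hg)
    fun x => add_le_add (hC x) (hD x)) ?_
  refine ((hμ.tendsto_lintegral hf hC).add (hμ.tendsto_lintegral hg hD)).congr fun n => ?_
  push_cast
  exact (lintegral_add_left hf.measurable.coe_nnreal_ennreal _).symm

theorem limitIntegral_sum {X : Type*} [TopologicalSpace X] [MeasurableSpace X]
    [BorelSpace X] {μ : ℕ → ProbabilityMeasure X} (hμ : WeaklyCauchy μ) (s : Finset ℕ)
    {f : ℕ → X → ℝ≥0} (hf : ∀ i, Continuous (f i)) (h1 : ∀ i x, f i x ≤ 1) :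
    limitIntegral μ (fun x => ∑ i ∈ s, f i x) = ∑ i ∈ s, limitIntegral μ (f i) := by
  induction s using Finset.induction_on with
  | empty => simp [limitIntegral]
  | insert a s ha ih =>
    simp only [Finset.sum_insert ha]
    rw [← ih]
    exact hμ.limitIntegral_add (hf a) (continuous_finsetSum _ fun i _ => hf i) (h1 a)
      (D := ∑ i ∈ s, 1) fun x => Finset.sum_le_sum fun i _ => h1 i x

/-- Monotone convergence for the limit integral. -/
theorem limitIntegral_le_iSup {X : Type*} [TopologicalSpace X] [MeasurableSpace X]
    [BorelSpace X] {μ : ℕ → ProbabilityMeasure X} (hμ : WeaklyCauchy μ) {f : X → ℝ≥0}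
    {p : ℕ → X → ℝ≥0} (hf : Continuous f) (hp : ∀ k, Continuous (p k)) {C : ℝ≥0}
    (hC : ∀ x, f x ≤ C) (hmono : ∀ x, Monotone fun k => p k x)
    (hlim : ∀ x, Tendsto (fun k => p k x) atTop (𝓝 (f x))) :
    limitIntegral μ f ≤ ⨆ k, limitIntegral μ (p k) := by
  have hle : ∀ k x, p k x ≤ f x := fun k x => (hmono x).ge_of_tendsto (hlim x) k
  refine ENNReal.le_of_forall_pos_le_add fun ε hε _ => ?_
  obtain ⟨K, N, h⟩ := hμ.exists_integral_le_of_antitone (fun k x => (f x : ℝ) - p k x)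
    (fun k => (NNReal.continuous_coe.comp hf).sub (NNReal.continuous_coe.comp (hp k)))
    (fun x k l hkl => sub_le_sub_left (NNReal.coe_le_coe.2 (hmono x hkl)) _) (C := C)
    (fun x => (sub_le_self _ (NNReal.coe_nonneg _)).trans (NNReal.coe_le_coe.2 (hC x)))
    (fun x => by
      have := (tendsto_const_nhds (x := (f x : ℝ))).sub (NNReal.tendsto_coe.2 (hlim x))
      simpa using this)
    (ε := ε) hε
  let r : X → ℝ≥0 := fun x => f x - p K x
  have hr : Continuous r := hf.sub (hp K)
  have hrC : ∀ x, r x ≤ C := fun x => tsub_le_self.trans (hC x)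
  have hrc : ∀ x, (r x : ℝ) = f x - p K x := fun x => NNReal.coe_sub (hle K x)
  have hrL : limitIntegral μ r ≤ ε := by
    refine le_of_tendsto (hμ.tendsto_lintegral hr hrC) (eventually_atTop.2 ⟨N, fun n hn => ?_⟩)
    have := h n hn
    simp only [← hrc] at this
    rw [lintegral_coe_eq_integral]
    · rw [← ENNReal.ofReal_coe_nnreal]
      exact ENNReal.ofReal_le_ofReal this
    · refine Integrable.of_bound (NNReal.continuous_coe.comp hr).measurable.aestronglyMeasurable C
        (ae_of_all _ fun x => ?_)
      simpa using hrC x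
  have hsum : f = fun x => p K x + r x := funext fun x => (add_tsub_cancel_of_le (hle K x)).symm
  calc limitIntegral μ f = limitIntegral μ (p K) + limitIntegral μ r := by
        conv_lhs => rw [hsum]
        exact hμ.limitIntegral_add (hp K) hr (fun x => (hle K x).trans (hC x)) hrC
    _ ≤ _ := add_le_add (le_iSup (fun k => limitIntegral μ (p k)) K) hrL

/-- Any competitor `f` for the union is an increasing limit of functions dominated by finite sums of
competitors for the `G i`, so monotone convergence for the limit integral applies. -/
theorem limitContent_iUnion_le {X : Type*} [MetricSpace X] [MeasurableSpace X]
    [BorelSpace X] {μ : ℕ → ProbabilityMeasure X} (hμ : WeaklyCauchy μ) (G : ℕ → Set X)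
    (hG : ∀ i, IsOpen (G i)) :
    limitContent μ (⋃ i, G i) ≤ ∑' i, limitContent μ (G i) := by
  have hδ : ∀ n : ℕ, 0 < 1 / ((n : ℝ) + 1) := fun n => by positivity
  let φ : ℕ → ℕ → X → ℝ≥0 := fun k i x => 1 - thickenedIndicator (hδ k) (G i)ᶜ x
  have hφc : ∀ k i, Continuous (φ k i) := fun k i =>
    continuous_const.sub (thickenedIndicator (hδ k) (G i)ᶜ).continuous
  have hφ1 : ∀ k i x, φ k i x ≤ 1 := fun k i x => tsub_le_self
  have hφG : ∀ k i x, φ k i x ≤ (G i).indicator 1 x := by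
    intro k i x
    by_cases hx : x ∈ G i
    · simpa [hx] using hφ1 k i x
    · have h1 := thickenedIndicator_one (hδ k) (G i)ᶜ (x := x) hx
      simp only [φ, h1, tsub_self, zero_le]
  have hφm : ∀ i x, Monotone fun k => φ k i x := by
    intro i x k l hkl
    refine tsub_le_tsub_left ?_ _
    exact thickenedIndicator_mono (hδ l) (hδ k) (by gcongr) _ x
  have hφl : ∀ i x, x ∈ G i → Tendsto (fun k => φ k i x) atTop (𝓝 1) := by
    intro i x hx
    have h1 := tendsto_pi_nhds.1 (thickenedIndicator_tendsto_indicator_closure hδ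
      tendsto_one_div_add_atTop_nhds_zero_nat (G i)ᶜ) x
    rw [(hG i).isClosed_compl.closure_eq, Set.indicator_of_notMem (by simpa using hx)] at h1
    have := (tendsto_const_nhds (x := (1 : ℝ≥0))).sub h1
    simpa [φ] using this
  refine iSup_le fun f => ?_
  obtain ⟨f, hf, hfG⟩ := f
  have hf1 : ∀ x, f x ≤ 1 := fun x => (hfG x).trans (by
    by_cases hx : x ∈ ⋃ i, G i <;> simp [Set.indicator, hx])
  -- The index `k` both admits more sets and sharpens each `φ k i`, so a single sequence increases
  -- to `f`.
  let p : ℕ → X → ℝ≥0 := fun k x => f x * min 1 (∑ i ∈ Finset.range (k + 1), φ k i x)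
  have hsc : ∀ k, Continuous fun x => ∑ i ∈ Finset.range (k + 1), φ k i x := fun k =>
    continuous_finsetSum _ fun i _ => hφc k i
  have hpm : ∀ x, Monotone fun k => p k x := by
    intro x k l hkl
    refine mul_le_mul_right (min_le_min_left _ ?_) _
    calc ∑ i ∈ Finset.range (k + 1), φ k i x ≤ ∑ i ∈ Finset.range (k + 1), φ l i x :=
          Finset.sum_le_sum fun i _ => hφm i x hkl
      _ ≤ _ := Finset.sum_le_sum_of_subset (Finset.range_mono (by omega))
  have hpl : ∀ x, Tendsto (fun k => p k x) atTop (𝓝 (f x)) := by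
    intro x
    by_cases hx : x ∈ ⋃ i, G i
    · obtain ⟨i, hi⟩ := Set.mem_iUnion.1 hx
      have : Tendsto (fun k => min 1 (∑ i ∈ Finset.range (k + 1), φ k i x)) atTop (𝓝 1) := by
        refine tendsto_of_tendsto_of_tendsto_of_le_of_le' (hφl i x hi) tendsto_const_nhds ?_
          (Eventually.of_forall fun k => min_le_left _ _)
        filter_upwards [eventually_ge_atTop i] with k hk
        refine le_min (hφ1 k i x) ?_
        exact Finset.single_le_sum (f := fun i => φ k i x) (fun _ _ => zero_le)
          (Finset.mem_range.2 (by omega))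
      simpa [p] using this.const_mul (f x)
    · have : f x = 0 := by simpa [hx] using hfG x
      simp [p, this]
  refine (hμ.limitIntegral_le_iSup hf (fun k => hf.mul (continuous_const.min (hsc k))) hf1
    hpm hpl).trans (iSup_le fun k => ?_)
  calc limitIntegral μ (p k)
      ≤ limitIntegral μ (fun x => ∑ i ∈ Finset.range (k + 1), φ k i x) :=
        limitIntegral_mono μ fun x => (mul_le_of_le_one_left zero_le (hf1 x)).trans
          (min_le_right _ _)
    _ = ∑ i ∈ Finset.range (k + 1), limitIntegral μ (φ k i) :=
        hμ.limitIntegral_sum _ (hφc k) (hφ1 k)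
    _ ≤ ∑ i ∈ Finset.range (k + 1), limitContent μ (G i) :=
        Finset.sum_le_sum fun i _ => le_iSup_of_le ⟨φ k i, hφc k i, hφG k i⟩ le_rfl
    _ ≤ _ := ENNReal.sum_le_tsum _

theorem limitContent_add_le {X : Type*} [TopologicalSpace X] [MeasurableSpace X]
    [BorelSpace X] {μ : ℕ → ProbabilityMeasure X} (hμ : WeaklyCauchy μ) {G H : Set X}
    (hGH : Disjoint G H) :
    limitContent μ G + limitContent μ H ≤ limitContent μ (G ∪ H) := by
  have hne : ∀ U : Set X, Nonempty {f : X → ℝ≥0 // Continuous f ∧ ∀ x, f x ≤ U.indicator 1 x} :=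
    fun U => ⟨⟨fun _ => 0, continuous_const, fun x => zero_le⟩⟩
  have := hne G
  have := hne H
  have hle : ∀ (U : Set X) x, U.indicator (1 : X → ℝ≥0) x ≤ 1 := fun U x =>
    Set.indicator_le_self' (fun _ _ => zero_le) x
  refine ENNReal.iSup_add_iSup_le fun f g => ?_
  rw [← hμ.limitIntegral_add f.2.1 g.2.1 (fun x => (f.2.2 x).trans (hle _ x))
    (fun x => (g.2.2 x).trans (hle _ x))]
  refine le_iSup_of_le ⟨fun x => f.1 x + g.1 x, f.2.1.add g.2.1, fun x => ?_⟩ le_rfl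
  rw [Set.indicator_union_of_disjoint hGH]
  exact add_le_add (f.2.2 x) (g.2.2 x)

/-- Alexandrov's theorem: a weakly Cauchy sequence of Borel probability measures on a metric space
converges weakly to a Borel probability measure. -/
theorem exists_tendsto {X : Type*} [MetricSpace X] [MeasurableSpace X]
    [BorelSpace X] {μ : ℕ → ProbabilityMeasure X} (hμ : WeaklyCauchy μ) :
    ∃ ν : ProbabilityMeasure X, Tendsto μ atTop (𝓝 ν) := by
  let m : OuterMeasure X := inducedOuterMeasure (P := IsOpen) (fun G _ => limitContent μ G)
    isOpen_empty (limitContent_empty μ)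
  have PU : ∀ ⦃f : ℕ → Set X⦄, (∀ i, IsOpen (f i)) → IsOpen (⋃ i, f i) := fun f hf =>
    isOpen_iUnion hf
  have hm : ∀ G, IsOpen G → m G = limitContent μ G := fun G hG =>
    inducedOuterMeasure_eq' PU (fun f hf => hμ.limitContent_iUnion_le f hf)
      (fun _ _ _ _ h => limitContent_mono μ h) hG
  have hmetric : m.IsMetric := by
    rintro s t ⟨r, hr, hst⟩
    refine le_antisymm (measure_union_le s t) ?_
    have hexp : m (s ∪ t) = _ :=
      inducedOuterMeasure_eq_iInf PU (fun f hf => hμ.limitContent_iUnion_le f hf)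
        (fun _ _ _ _ h => limitContent_mono μ h) (s ∪ t)
    rw [hexp]
    refine le_iInf₂ fun W hW => le_iInf fun hsub => ?_
    -- The points nearer to `s` and those nearer to `t` form disjoint open sets; they split any open
    -- cover `W` of `s ∪ t`.
    let U : Set X := {x | Metric.infEDist x s < Metric.infEDist x t}
    let V : Set X := {x | Metric.infEDist x t < Metric.infEDist x s}
    have hU : IsOpen U := isOpen_lt Metric.continuous_infEDist Metric.continuous_infEDist
    have hV : IsOpen V := isOpen_lt Metric.continuous_infEDist Metric.continuous_infEDist
    have hd : Disjoint (W ∩ U) (W ∩ V) := Set.disjoint_left.2 fun x hx hy =>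
      lt_asymm (show Metric.infEDist x s < Metric.infEDist x t from hx.2) hy.2
    have hsU : s ⊆ W ∩ U := fun x hx => ⟨hsub (Or.inl hx), by
      change Metric.infEDist x s < Metric.infEDist x t
      rw [Metric.infEDist_zero_of_mem hx]
      exact (pos_iff_ne_zero.2 hr).trans_le (Metric.le_infEDist.2 fun y hy => hst x hx y hy)⟩
    have htV : t ⊆ W ∩ V := fun x hx => ⟨hsub (Or.inr hx), by
      change Metric.infEDist x t < Metric.infEDist x s
      rw [Metric.infEDist_zero_of_mem hx]
      exact (pos_iff_ne_zero.2 hr).trans_le (Metric.le_infEDist.2 fun y hy => by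
        rw [edist_comm]
        exact hst y hy x hx)⟩
    calc m s + m t ≤ m (W ∩ U) + m (W ∩ V) := add_le_add (measure_mono hsU) (measure_mono htV)
      _ = limitContent μ (W ∩ U) + limitContent μ (W ∩ V) := by
          rw [hm _ (hW.inter hU), hm _ (hW.inter hV)]
      _ ≤ limitContent μ (W ∩ U ∪ W ∩ V) := hμ.limitContent_add_le hd
      _ ≤ limitContent μ W := limitContent_mono μ
          (Set.union_subset Set.inter_subset_left Set.inter_subset_left)
  let ν : Measure X := m.toMeasure hmetric.le_caratheodory
  have hν : ∀ G, IsOpen G → ν G = limitContent μ G := fun G hG => by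
    rw [← hm G hG]
    exact toMeasure_apply _ _ hG.measurableSet
  have : IsProbabilityMeasure ν := ⟨(hν _ isOpen_univ).trans (limitContent_univ μ)⟩
  refine ⟨⟨ν, this⟩, tendsto_of_forall_isOpen_le_liminf' fun G hG => ?_⟩
  exact (hν G hG).le.trans (limitContent_le_liminf μ hG)

end WeaklyCauchy

/-! ### Mean ergodic theorem for semidefinite forms. -/

/-- The mean ergodic theorem for a contraction of a semi-inner product space: Birkhoff averages are
Cauchy. -/
theorem cauchySeq_birkhoffAverage_of_contraction {E : Type*} [SeminormedAddCommGroup E]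
    [InnerProductSpace ℝ E] (T : E →L[ℝ] E) (hT : ∀ x, ‖T x‖ ≤ ‖x‖) (x : E) :
    CauchySeq fun n => birkhoffAverage ℝ T id n x := by
  -- The completion is a Hilbert space, where averages converge to a projection; the canonical map
  -- preserves distances, so the Cauchy property descends.
  have hle : ‖T.completion‖ ≤ 1 := by
    refine ContinuousLinearMap.opNorm_le_bound _ zero_le_one fun y => ?_
    induction y using UniformSpace.Completion.induction_on with
    | hp => exact isClosed_le T.completion.continuous.norm (continuous_const.mul continuous_norm)
    | ih y => simpa using hT y
  have h := (T.completion.tendsto_birkhoffAverage_orthogonalProjection hle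
    (x : UniformSpace.Completion E)).cauchySeq
  have hiter : ∀ k, T.completion^[k] (x : UniformSpace.Completion E) = ((T^[k] x : E)) := by
    intro k
    induction k with
    | zero => rfl
    | succ k ih => rw [Function.iterate_succ_apply', Function.iterate_succ_apply', ih]; simp
  have heq : ∀ n, birkhoffAverage ℝ T.completion id n (x : UniformSpace.Completion E) =
      ((birkhoffAverage ℝ T id n x : E) : UniformSpace.Completion E) := by
    intro n
    have := map_birkhoffAverage ℝ ℝ (UniformSpace.Completion.toComplL (𝕜 := ℝ) (E := E)) T id n x
    rw [UniformSpace.Completion.coe_toComplL] at this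
    rw [this]
    simp [birkhoffAverage, birkhoffSum, hiter]
  rw [Metric.cauchySeq_iff] at h ⊢
  intro ε hε
  obtain ⟨N, hN⟩ := h ε hε
  refine ⟨N, fun m hm n hn => ?_⟩
  have := hN m hm n hn
  rwa [heq, heq, UniformSpace.Completion.dist_eq] at this

/-- The mean ergodic theorem for a linear map that contracts a positive semidefinite form. -/
theorem exists_form_birkhoffAverage_sub_lt {V : Type*} [AddCommGroup V] [Module ℝ V]
    (B : V →ₗ[ℝ] V →ₗ[ℝ] ℝ) (hsymm : ∀ v w, B v w = B w v) (hpos : ∀ v, 0 ≤ B v v)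
    (T : V →ₗ[ℝ] V) (hT : ∀ v, B (T v) (T v) ≤ B v v) (v : V) {ε : ℝ} (hε : 0 < ε) :
    ∃ N, ∀ m, N ≤ m → ∀ n, N ≤ n →
      B (birkhoffAverage ℝ T id m v - birkhoffAverage ℝ T id n v)
        (birkhoffAverage ℝ T id m v - birkhoffAverage ℝ T id n v) < ε := by
  -- The form may be degenerate, so it yields only a seminorm.
  let core : PreInnerProductSpace.Core ℝ V :=
    { inner := fun v w => B v w
      conj_inner_symm := fun v w => by simpa using hsymm w v
      re_inner_nonneg := fun v => by simpa using hpos v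
      add_left := fun u v w => by simp
      smul_left := fun v w r => by simp }
  let : SeminormedAddCommGroup V := InnerProductSpace.Core.toSeminormedAddCommGroup (c := core)
  let : InnerProductSpace ℝ V := InnerProductSpace.ofCore core
  have hn : ∀ w : V, ‖w‖ = √(B w w) := fun w => rfl
  have hTn : ∀ w, ‖T w‖ ≤ ‖w‖ := fun w => by
    rw [hn, hn]
    exact Real.sqrt_le_sqrt (hT w)
  have h := cauchySeq_birkhoffAverage_of_contraction
    (T.mkContinuous 1 fun w => by simpa using hTn w) hTn v
  obtain ⟨N, hN⟩ := Metric.cauchySeq_iff.1 h (√ε) (Real.sqrt_pos.2 hε)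
  refine ⟨N, fun m hm n hn' => ?_⟩
  have := hN m hm n hn'
  rw [dist_eq_norm, hn, Real.sqrt_lt_sqrt_iff (hpos _)] at this
  exact this

/-! ### Limit functionals and the semigroup on `C_b(X)`. -/

/-- Along an ultrafilter, the integrals against a sequence of probability measures converge to a
linear functional on bounded continuous functions. -/
theorem exists_ultrafilter_limit_functional {X : Type*} [TopologicalSpace X] [MeasurableSpace X]
    [BorelSpace X] (μ : ℕ → ProbabilityMeasure X) (l : Ultrafilter ℕ) :
    ∃ Λ : BoundedContinuousFunction X ℝ →ₗ[ℝ] ℝ, ∀ f,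
      Tendsto (fun n => ∫ x, f x ∂(μ n : Measure X)) l (𝓝 (Λ f)) := by
  have hex : ∀ f : BoundedContinuousFunction X ℝ, ∃ a,
      Tendsto (fun n => ∫ x, f x ∂(μ n : Measure X)) l (𝓝 a) := by
    intro f
    obtain ⟨a, _, ha⟩ := (isCompact_Icc (a := -‖f‖) (b := ‖f‖)).ultrafilter_le_nhds'
      (l.map fun n => ∫ x, f x ∂(μ n : Measure X)) (by
        refine Filter.mem_map.2 (Filter.univ_mem' fun n => ?_)
        have := f.norm_integral_le_norm (μ n : Measure X)
        exact abs_le.1 this)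
    exact ⟨a, ha⟩
  choose Λ hΛ using hex
  exact ⟨{ toFun := Λ
           map_add' := fun f g => tendsto_nhds_unique (hΛ (f + g))
             (((hΛ f).add (hΛ g)).congr fun n => (integral_add (f.integrable _)
               (g.integrable _)).symm)
           map_smul' := fun c f => tendsto_nhds_unique (hΛ (c • f))
             (((hΛ f).const_mul c).congr fun n => (integral_const_mul c _).symm) }, hΛ⟩

/-- A bounded continuous function as an element of `B_b(X)`. -/
def BoundedContinuousFunction.toBoundedMeasurable {X : Type*} [TopologicalSpace X]
    [MeasurableSpace X] [BorelSpace X] :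
    BoundedContinuousFunction X ℝ →ₗ[ℝ] BoundedMeasurable X where
  toFun f := ⟨f, f.continuous.measurable, ‖f‖, fun x => f.norm_coe_le_norm x⟩
  map_add' _ _ := rfl
  map_smul' _ _ := rfl

namespace FellerSemigroup

/-- The action of a Feller semigroup on bounded continuous functions. -/
noncomputable def onBCF {X : Type*} [TopologicalSpace X] [MeasurableSpace X] [BorelSpace X]
    (S : FellerSemigroup X) (t : ℝ≥0) :
    BoundedContinuousFunction X ℝ →ₗ[ℝ] BoundedContinuousFunction X ℝ where
  toFun f := BoundedContinuousFunction.ofNormedAddCommGroup (S.P t f.toBoundedMeasurable : X → ℝ)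
    (S.feller t _ f.continuous) ‖f‖
    (S.abs_apply_le t f.toBoundedMeasurable ‖f‖ fun x => f.norm_coe_le_norm x)
  map_add' f g := by
    ext x
    simp
  map_smul' c f := by
    ext x
    simp

variable {X : Type*} [MetricSpace X] [MeasurableSpace X] [BorelSpace X] (S : FellerSemigroup X)

theorem onBCF_apply (t : ℝ≥0) (f : BoundedContinuousFunction X ℝ) (x : X) :
    S.onBCF t f x = (S.P t f.toBoundedMeasurable : X → ℝ) x := rfl

theorem onBCF_zero (f : BoundedContinuousFunction X ℝ) : S.onBCF 0 f = f := by
  ext x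
  rw [onBCF_apply, S.P_zero]
  rfl

theorem onBCF_add (s t : ℝ≥0) (f : BoundedContinuousFunction X ℝ) :
    S.onBCF (s + t) f = S.onBCF s (S.onBCF t f) := by
  ext x
  rw [onBCF_apply, S.P_add]
  rfl

theorem abs_onBCF_le (t : ℝ≥0) (f : BoundedContinuousFunction X ℝ) (x : X) :
    |S.onBCF t f x| ≤ ‖f‖ :=
  S.abs_apply_le t f.toBoundedMeasurable ‖f‖ (fun x => f.norm_coe_le_norm x) x

theorem iterate_onBCF_one (k : ℕ) (f : BoundedContinuousFunction X ℝ) :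
    (S.onBCF 1)^[k] f = S.onBCF k f := by
  induction k with
  | zero => simp [onBCF_zero]
  | succ k ih =>
    rw [Function.iterate_succ_apply', ih, ← onBCF_add, add_comm]
    norm_num

theorem birkhoffAverage_onBCF_apply (n : ℕ) (f : BoundedContinuousFunction X ℝ) (x : X) :
    birkhoffAverage ℝ (S.onBCF 1) id n f x = (n : ℝ)⁻¹ * ∑ k ∈ Finset.range n, S.onBCF k f x := by
  simp [birkhoffAverage, birkhoffSum, iterate_onBCF_one]

/-- Jensen's inequality for the square. -/
theorem sq_onBCF_le (t : ℝ≥0) (f : BoundedContinuousFunction X ℝ) (x : X) :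
    S.onBCF t f x * S.onBCF t f x ≤ S.onBCF t (f * f) x := by
  set c := S.onBCF t f x with hc
  have hone : S.onBCF t 1 x = 1 := by
    have h := congrArg (fun φ : BoundedMeasurable X => (φ : X → ℝ) x) (S.P_one t)
    exact h
  -- Positivity is applied to `(f - c)²` with the constant `c = P_t f(x)` frozen at the point `x`.
  have h := S.P_nonneg t
    (f * f - (2 * c) • f + (c * c) • (1 : BoundedContinuousFunction X ℝ)).toBoundedMeasurable
    (fun y => by
      change 0 ≤ f y * f y - 2 * c * f y + c * c * 1
      nlinarith [sq_nonneg (f y - c)]) x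
  rw [← onBCF_apply, map_add, map_sub, map_smul, map_smul] at h
  simp only [BoundedContinuousFunction.coe_add, BoundedContinuousFunction.coe_sub,
    BoundedContinuousFunction.coe_smul, Pi.add_apply, Pi.sub_apply, smul_eq_mul, hone, ← hc] at h
  linarith

theorem integral_dual (t : ℝ≥0) (μ : ProbabilityMeasure X) (f : BoundedContinuousFunction X ℝ) :
    ∫ x, f x ∂(S.dual t μ : Measure X) = ∫ x, S.onBCF t f x ∂(μ : Measure X) :=
  (S.duality t f.toBoundedMeasurable μ).symm

theorem integral_dual_dirac (t : ℝ≥0) (z : X) (f : BoundedContinuousFunction X ℝ) :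
    ∫ x, f x ∂(S.dual t (diracProba z) : Measure X) = S.onBCF t f z := by
  rw [integral_dual]
  exact integral_dirac' _ _ (S.onBCF t f).continuous.measurable.stronglyMeasurable

theorem measurable_onBCF_apply (f : BoundedContinuousFunction X ℝ) (z : X) :
    Measurable fun s : ℝ => S.onBCF s.toNNReal f z := by
  have h := (S.measurable_pairing (diracProba z) f.toBoundedMeasurable f.continuous).comp
    measurable_real_toNNReal
  convert h using 1
  funext s
  exact (S.integral_dual_dirac s.toNNReal z f).symm

theorem intervalIntegrable_onBCF_apply (f : BoundedContinuousFunction X ℝ) (z : X) (a b : ℝ) :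
    IntervalIntegrable (fun s : ℝ => S.onBCF s.toNNReal f z) volume a b := by
  refine (intervalIntegrable_const (c := ‖f‖)).mono_fun
    (S.measurable_onBCF_apply f z).aestronglyMeasurable (ae_of_all _ fun s => ?_)
  simpa using S.abs_onBCF_le s.toNNReal f z

/-! ### Time averages and their asymptotic invariance. -/

theorem integral_timeAverage (t : ℝ) (ht : 0 < t) (z : X) (f : BoundedContinuousFunction X ℝ) :
    ∫ x, f x ∂(S.timeAverage t ht (diracProba z) : Measure X) =
      1 / t * ∫ s in (0 : ℝ)..t, S.onBCF s.toNNReal f z := by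
  let η : ProbabilityTheory.Kernel ℝ X := ⟨fun s => (S.dual s.toNNReal (diracProba z) : Measure X),
    S.measurable_dual_toNNReal (diracProba z)⟩
  have : ProbabilityTheory.IsMarkovKernel η := ⟨fun s => (S.dual s.toNNReal (diracProba z)).2⟩
  have h := ProbabilityTheory.Kernel.integral_comp (f := f) (η := η)
    (κ := ProbabilityTheory.Kernel.const Unit (volume.restrict (Set.Ioc 0 t))) (a := ())
    (f.integrable _)
  rw [ProbabilityTheory.Kernel.comp_apply, ProbabilityTheory.Kernel.const_apply] at h
  have h2 : (S.timeAverage t ht (diracProba z) : Measure X) =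
    (ENNReal.ofReal t)⁻¹ • Measure.bind (volume.restrict (Set.Ioc 0 t)) η := rfl
  rw [h2, integral_smul_measure, h, intervalIntegral.integral_of_le ht.le, ENNReal.toReal_inv,
    ENNReal.toReal_ofReal ht.le, one_div, smul_eq_mul]
  congr 1
  exact integral_congr_ae (ae_of_all _ fun s => S.integral_dual_dirac s.toNNReal z f)

/-- Time averages are asymptotically invariant. -/
theorem abs_integral_timeAverage_onBCF_sub_le (t : ℝ) (ht : 0 < t) (z : X) (r : ℝ≥0)
    (f : BoundedContinuousFunction X ℝ) :
    |∫ x, S.onBCF r f x ∂(S.timeAverage t ht (diracProba z) : Measure X) -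
      ∫ x, f x ∂(S.timeAverage t ht (diracProba z) : Measure X)| ≤ 1 / t * (2 * r * ‖f‖) := by
  let u : ℝ → ℝ := fun s => S.onBCF s.toNNReal f z
  have hi : ∀ a b, IntervalIntegrable u volume a b := S.intervalIntegrable_onBCF_apply f z
  have hub : ∀ s, ‖u s‖ ≤ ‖f‖ := fun s => S.abs_onBCF_le s.toNNReal f z
  have hshift : ∫ s in (0 : ℝ)..t, S.onBCF s.toNNReal (S.onBCF r f) z =
      ∫ s in (0 + r : ℝ)..(t + r), u s := by
    rw [← intervalIntegral.integral_comp_add_right]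
    refine intervalIntegral.integral_congr fun s hs => ?_
    rw [Set.uIcc_of_le ht.le] at hs
    simp only [u]
    rw [Real.toNNReal_add hs.1 (NNReal.coe_nonneg r), Real.toNNReal_coe, onBCF_add]
  rw [integral_timeAverage, integral_timeAverage, hshift, ← mul_sub, abs_mul,
    abs_of_pos (show 0 < 1 / t by positivity)]
  refine mul_le_mul_of_nonneg_left ?_ (by positivity)
  have h1 := intervalIntegral.integral_add_adjacent_intervals (hi 0 t) (hi t (t + r))
  have h2 := intervalIntegral.integral_add_adjacent_intervals (hi 0 (0 + r)) (hi (0 + r) (t + r))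
  have h3 := intervalIntegral.norm_integral_le_of_norm_le_const (a := t) (b := t + r)
    fun s _ => hub s
  have h4 := intervalIntegral.norm_integral_le_of_norm_le_const (a := 0) (b := 0 + r)
    fun s _ => hub s
  simp only [add_sub_cancel_left, NNReal.abs_eq, Real.norm_eq_abs] at h3 h4
  -- After cancellation only two end intervals of length `r` remain.
  have e : (∫ s in (0 + r : ℝ)..(t + r), u s) - ∫ s in (0 : ℝ)..t, u s =
      (∫ s in t..(t + r), u s) - ∫ s in (0 : ℝ)..(0 + r), u s := by linarith
  change |(∫ s in (0 + r : ℝ)..(t + r), u s) - ∫ s in (0 : ℝ)..t, u s| ≤ _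
  rw [e]
  refine (abs_sub _ _).trans ?_
  linarith

theorem tendsto_integral_timeAverage_onBCF_sub (z : X) (r : ℝ≥0)
    (f : BoundedContinuousFunction X ℝ) :
    Tendsto (fun n : ℕ =>
      ∫ x, S.onBCF r f x ∂(S.timeAverage ((n : ℝ) + 1) (by positivity) (diracProba z) : Measure X) -
      ∫ x, f x ∂(S.timeAverage ((n : ℝ) + 1) (by positivity) (diracProba z) : Measure X))
      atTop (𝓝 0) := by
  refine squeeze_zero_norm (fun n => S.abs_integral_timeAverage_onBCF_sub_le _ _ z r f) ?_
  simpa using (tendsto_one_div_add_atTop_nhds_zero_nat (𝕜 := ℝ)).mul_const (2 * r * ‖f‖)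

/-! ### Convergence of the averages at `z`. -/

/-- If the time averages of `δ_z` do not leave the neighbourhoods of `z` and the orbit of `f` is
equicontinuous at `z`, then the discrete averages of the orbit of `f` are Cauchy at `z`. -/
theorem cauchySeq_birkhoffAverage_onBCF (z : X)
    (hz : ∀ ε : ℝ, 0 < ε → ∃ c : ℝ, 0 < c ∧ ∀ᶠ n : ℕ in atTop,
      c ≤ (S.timeAverage ((n : ℝ) + 1) (by positivity) (diracProba z) (Metric.ball z ε) : ℝ))
    (f : BoundedContinuousFunction X ℝ)
    (hf : EquicontinuousAt (fun (t : ℝ≥0) (x : X) => S.onBCF t f x) z) :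
    CauchySeq fun n => birkhoffAverage ℝ (S.onBCF 1) id n f z := by
  let Q : ℕ → ProbabilityMeasure X := fun n =>
    S.timeAverage ((n : ℝ) + 1) (by positivity) (diracProba z)
  have hle : ((hyperfilter ℕ : Ultrafilter ℕ) : Filter ℕ) ≤ atTop := Nat.hyperfilter_le_atTop
  obtain ⟨Λ, hΛ⟩ := exists_ultrafilter_limit_functional Q (hyperfilter ℕ)
  have hmono : ∀ g h : BoundedContinuousFunction X ℝ, (∀ x, g x ≤ h x) → Λ g ≤ Λ h :=
    fun g h hgh => le_of_tendsto_of_tendsto' (hΛ g) (hΛ h) fun n =>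
      integral_mono (g.integrable _) (h.integrable _) hgh
  have hinv : ∀ g, Λ (S.onBCF 1 g) = Λ g := fun g => by
    refine sub_eq_zero.1 (tendsto_nhds_unique ((hΛ _).sub (hΛ g)) ?_)
    exact (S.tendsto_integral_timeAverage_onBCF_sub z 1 g).mono_left hle
  have hpos : ∀ g : BoundedContinuousFunction X ℝ, (∀ x, 0 ≤ g x) → 0 ≤ Λ g := fun g hg => by
    simpa using hmono 0 g hg
  rw [Metric.cauchySeq_iff]
  intro ε hε
  obtain ⟨δ, hδ, hfδ⟩ := Metric.equicontinuousAt_iff.1 hf (ε / 3) (by positivity)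
  have havg : ∀ n x, dist x z < δ → |birkhoffAverage ℝ (S.onBCF 1) id n f x -
      birkhoffAverage ℝ (S.onBCF 1) id n f z| ≤ ε / 3 := by
    intro n x hx
    rw [birkhoffAverage_onBCF_apply, birkhoffAverage_onBCF_apply, ← mul_sub,
      ← Finset.sum_sub_distrib, abs_mul, abs_of_nonneg (by positivity)]
    rcases Nat.eq_zero_or_pos n with rfl | hn
    · simpa using (show 0 ≤ ε / 3 by positivity)
    calc (n : ℝ)⁻¹ * |∑ k ∈ Finset.range n, (S.onBCF k f x - S.onBCF k f z)|
        ≤ (n : ℝ)⁻¹ * ∑ k ∈ Finset.range n, ε / 3 := by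
          refine mul_le_mul_of_nonneg_left ((Finset.abs_sum_le_sum_abs _ _).trans
            (Finset.sum_le_sum fun k _ => ?_)) (by positivity)
          have := hfδ x hx k
          rw [dist_comm, Real.dist_eq] at this
          exact this.le
      _ = ε / 3 := by
          have : (n : ℝ) ≠ 0 := by positivity
          simp
          field_simp
  -- A tent at `z`, zero off the `δ`-ball and at least `1 / 2` on the `δ / 2`-ball, so that `Λ χ ≥ c
  -- / 2`.
  let χ : BoundedContinuousFunction X ℝ := BoundedContinuousFunction.ofNormedAddCommGroup
    (fun x => max 0 (1 - dist x z / δ)) (by fun_prop) 1 (fun x => by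
      rw [Real.norm_eq_abs, abs_of_nonneg (le_max_left _ _)]
      exact max_le zero_le_one (by linarith [show 0 ≤ dist x z / δ by positivity]))
  have hχ : ∀ x, χ x = max 0 (1 - dist x z / δ) := fun x => rfl
  have hχΛ : 0 < Λ χ := by
    obtain ⟨c, hc, hcn⟩ := hz (δ / 2) (by positivity)
    refine (show 0 < c / 2 by positivity).trans_le (ge_of_tendsto (hΛ χ) (hle ?_))
    filter_upwards [hcn] with n hn
    have hmeas : MeasurableSet (Metric.ball z (δ / 2)) := Metric.isOpen_ball.measurableSet
    calc c / 2 ≤ ∫ x, (Metric.ball z (δ / 2)).indicator (fun _ => (1 / 2 : ℝ)) x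
          ∂(Q n : Measure X) := by
          rw [integral_indicator_const _ hmeas, smul_eq_mul]
          have hn' : c ≤ (Q n : Measure X).real (Metric.ball z (δ / 2)) := hn
          linarith
      _ ≤ ∫ x, χ x ∂(Q n : Measure X) := by
          refine integral_mono ((integrable_const _).indicator hmeas) (χ.integrable _) fun x => ?_
          by_cases hx : x ∈ Metric.ball z (δ / 2)
          · simp only [Set.indicator_of_mem hx, hχ]
            refine le_max_of_le_right ?_
            have : dist x z / δ ≤ 1 / 2 := by
              rw [div_le_iff₀ hδ]
              linarith [Metric.mem_ball.1 hx]
            linarith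
          · simp only [Set.indicator_of_notMem hx, hχ]
            exact le_max_left _ _
  -- The threshold is the least value of `Λ((a - b)²)` that a gap `ε` at `z` would force: two
  -- equicontinuity errors of `ε / 3` leave a gap of `ε / 3` on the `δ`-ball.
  obtain ⟨N, hN⟩ := exists_form_birkhoffAverage_sub_lt
    ((LinearMap.mul ℝ (BoundedContinuousFunction X ℝ)).compr₂ Λ)
    (fun g h => by simp [mul_comm g h])
    (fun g => hpos _ fun x => mul_self_nonneg (g x)) (S.onBCF 1)
    (fun g => by
      simp only [LinearMap.compr₂_apply, LinearMap.mul_apply']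
      rw [← hinv (g * g)]
      exact hmono _ _ fun x => S.sq_onBCF_le 1 g x) f
    (ε := (ε / 3) ^ 2 * Λ χ) (by positivity)
  refine ⟨N, fun m hm n hn => ?_⟩
  have h := hN m hm n hn
  by_contra! hcon
  rw [Real.dist_eq] at hcon
  refine h.not_ge ?_
  simp only [LinearMap.compr₂_apply, LinearMap.mul_apply']
  rw [← smul_eq_mul, ← map_smul]
  refine hmono _ _ fun x => ?_
  set a := birkhoffAverage ℝ (S.onBCF 1) id m f with ha
  set b := birkhoffAverage ℝ (S.onBCF 1) id n f with hb
  change (ε / 3) ^ 2 * χ x ≤ (a x - b x) * (a x - b x)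
  rw [hχ]
  rcases lt_or_ge (dist x z) δ with hx | hx
  · have h1 := havg m x hx
    have h2 := havg n x hx
    have h3 : ε / 3 ≤ |a x - b x| := by
      rcases abs_cases (a z - b z) with h4 | h4 <;> rcases abs_cases (a x - b x) with h5 | h5 <;>
        rw [abs_le] at h1 h2 <;> linarith [h1.1, h1.2, h2.1, h2.2]
    have h4 : max 0 (1 - dist x z / δ) ≤ 1 :=
      max_le zero_le_one (by linarith [show 0 ≤ dist x z / δ by positivity])
    calc (ε / 3) ^ 2 * max 0 (1 - dist x z / δ) ≤ (ε / 3) ^ 2 :=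
          mul_le_of_le_one_right (by positivity) h4
      _ ≤ |a x - b x| ^ 2 := by gcongr
      _ = _ := by rw [sq_abs, sq]
  · rw [max_eq_left (by linarith [(one_le_div hδ).2 hx]), mul_zero]
    exact mul_self_nonneg _

/-- Time averages over integer intervals as an average of discrete averages. -/
theorem integral_timeAverage_nat (n : ℕ) (hn : 0 < (n : ℝ)) (z : X)
    (f : BoundedContinuousFunction X ℝ) :
    ∫ x, f x ∂(S.timeAverage n hn (diracProba z) : Measure X) =
      ∫ s in (0 : ℝ)..1, birkhoffAverage ℝ (S.onBCF 1) id n (S.onBCF s.toNNReal f) z := by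
  have hi : ∀ a b, IntervalIntegrable (fun s : ℝ => S.onBCF s.toNNReal f z) volume a b :=
    S.intervalIntegrable_onBCF_apply f z
  have hshift : ∀ k : ℕ, ∀ s ∈ Set.uIcc (0 : ℝ) 1,
      S.onBCF k (S.onBCF s.toNNReal f) z = S.onBCF (s + k).toNNReal f z := by
    intro k s hs
    rw [Set.uIcc_of_le zero_le_one] at hs
    rw [← onBCF_add, Real.toNNReal_add hs.1 (Nat.cast_nonneg k), Real.toNNReal_natCast, add_comm]
  simp only [birkhoffAverage_onBCF_apply]
  rw [integral_timeAverage, intervalIntegral.integral_const_mul, one_div]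
  congr 1
  -- The interval `[0, n]` is cut into unit intervals, each shifted back to `[0, 1]`.
  have h0 := intervalIntegral.sum_integral_adjacent_intervals (n := n) (a := fun k : ℕ => (k : ℝ))
    (f := fun s : ℝ => S.onBCF s.toNNReal f z) (μ := volume) fun k _ => hi _ _
  rw [Nat.cast_zero] at h0
  rw [← h0, intervalIntegral.integral_congr fun s hs =>
      Finset.sum_congr rfl fun k _ => hshift k s hs,
    intervalIntegral.integral_finsetSum fun k _ => ?_]
  · refine Finset.sum_congr rfl fun k _ => ?_
    rw [intervalIntegral.integral_comp_add_right (fun s : ℝ => S.onBCF s.toNNReal f z)]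
    congr 1
    · simp
    · push_cast
      ring
  · simpa using (hi (0 + k) (1 + k)).comp_add_right (k : ℝ)

end FellerSemigroup

/-- Each `P_s f` is again in `C_b(X)`, so its discrete averages at `z` converge; dominated
convergence in `s ∈ [0, 1]` then handles the time averages. -/
theorem FellerSemigroup.weaklyCauchy_timeAverage {X : Type*} [MetricSpace X] [MeasurableSpace X]
    [BorelSpace X] (S : FellerSemigroup X) (z : X)
    (hz : ∀ ε : ℝ, 0 < ε → ∃ c : ℝ, 0 < c ∧ ∀ᶠ n : ℕ in atTop,
      c ≤ (S.timeAverage ((n : ℝ) + 1) (by positivity) (diracProba z) (Metric.ball z ε) : ℝ))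
    (he : ∀ f : BoundedContinuousFunction X ℝ,
      EquicontinuousAt (fun (t : ℝ≥0) (x : X) => S.onBCF t f x) z) :
    WeaklyCauchy fun n : ℕ => S.timeAverage ((n : ℝ) + 1) (by positivity) (diracProba z) := by
  rintro f hf ⟨C, hC⟩
  let φ : BoundedContinuousFunction X ℝ := BoundedContinuousFunction.ofNormedAddCommGroup f hf C hC
  let A : ℕ → ℝ → ℝ := fun n s =>
    birkhoffAverage ℝ (S.onBCF 1) id (n + 1) (S.onBCF s.toNNReal φ) z
  have hlim : ∀ s, ∃ l, Tendsto (fun n => A n s) atTop (𝓝 l) := fun s => by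
    obtain ⟨l, hl⟩ := cauchySeq_tendsto_of_complete
      (S.cauchySeq_birkhoffAverage_onBCF z hz (S.onBCF s.toNNReal φ) (he _))
    exact ⟨l, hl.comp (tendsto_add_atTop_nat 1)⟩
  choose l hl using hlim
  -- Commuting `P_s` past `P_k` puts `s` outermost, where measurability in time is known.
  have hA : ∀ n s, A n s =
      ((n + 1 : ℕ) : ℝ)⁻¹ * ∑ k ∈ Finset.range (n + 1), S.onBCF s.toNNReal (S.onBCF k φ) z := by
    intro n s
    simp only [A, birkhoffAverage_onBCF_apply]
    congr 1
    refine Finset.sum_congr rfl fun k _ => ?_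
    rw [← S.onBCF_add, ← S.onBCF_add, add_comm]
  have hmeas : ∀ n, Measurable (A n) := fun n => by
    rw [funext (hA n)]
    exact (Finset.measurable_fun_sum _ fun (k : ℕ) _ =>
      S.measurable_onBCF_apply (S.onBCF (k : ℝ≥0) φ) z).const_mul _
  have hbound : ∀ n s, ‖A n s‖ ≤ ‖φ‖ := by
    intro n s
    rw [hA, Real.norm_eq_abs, abs_mul, abs_of_pos (by positivity), inv_mul_le_iff₀ (by positivity)]
    refine (Finset.abs_sum_le_sum_abs _ _).trans ?_
    calc _ ≤ ∑ k ∈ Finset.range (n + 1), ‖φ‖ := Finset.sum_le_sum fun k _ => by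
          rw [← S.onBCF_add]
          exact S.abs_onBCF_le _ φ z
      _ = _ := by simp
  have hconv : Tendsto (fun n => ∫ s in (0 : ℝ)..1, A n s) atTop (𝓝 (∫ s in (0 : ℝ)..1, l s)) :=
    intervalIntegral.tendsto_integral_filter_of_dominated_convergence (fun _ => ‖φ‖)
      (Eventually.of_forall fun n => (hmeas n).aestronglyMeasurable)
      (Eventually.of_forall fun n => ae_of_all _ fun s _ => hbound n s)
      intervalIntegrable_const (ae_of_all _ fun s _ => hl s)
  refine (hconv.congr fun n => ?_).cauchySeq
  have h := S.integral_timeAverage_nat (n + 1) (by positivity) z φ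
  simp only [Nat.cast_add, Nat.cast_one] at h
  exact h.symm

/-! ### Invariance of the limit and conclusion. -/

/-- By the Feller property weak convergence tests both `f` and `P_t f`, whose averages differ by a
null sequence; bounded continuous functions determine a finite Borel measure on a metric space. -/
theorem FellerSemigroup.isInvariant_of_tendsto_timeAverage {X : Type*} [MetricSpace X]
    [MeasurableSpace X] [BorelSpace X] (S : FellerSemigroup X) (z : X) (μ : ProbabilityMeasure X)
    (h : Tendsto (fun n : ℕ => S.timeAverage ((n : ℝ) + 1) (by positivity) (diracProba z))
      atTop (𝓝 μ)) : S.IsInvariant μ := by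
  intro t
  rw [ProbabilityMeasure.tendsto_iff_forall_integral_tendsto] at h
  have h1 : IsProbabilityMeasure (S.dual t μ : Measure X) := (S.dual t μ).2
  have h2 : IsProbabilityMeasure (μ : Measure X) := μ.2
  refine Subtype.ext (ext_of_forall_integral_eq_of_IsFiniteMeasure (μ := (S.dual t μ : Measure X))
    (ν := (μ : Measure X)) fun f => ?_)
  have h3 := tendsto_nhds_unique ((h (S.onBCF t f)).sub (h f))
    (S.tendsto_integral_timeAverage_onBCF_sub z t f)
  exact (S.integral_dual t μ f).trans (sub_eq_zero.1 h3)

theorem proposition3p4 {X : Type*} [MetricSpace X] [MeasurableSpace X] [BorelSpace X]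
    (S : FellerSemigroup X) (z : X)
    (hz : ∀ ε : ℝ, 0 < ε → 0 < liminf (fun t : ℝ =>
      1 / t * ∫ s in (0 : ℝ)..t, (S.dual s.toNNReal (diracProba z) (Metric.ball z ε) : ℝ)) atTop)
    (he : ∀ φ : BoundedMeasurable X, Continuous (φ : X → ℝ) →
      EquicontinuousAt (fun (t : ℝ≥0) (x : X) => (S.P t φ : X → ℝ) x) z) :
    ∃ μ : ProbabilityMeasure X, S.IsInvariant μ ∧
      Tendsto (fun n : ℕ => S.timeAverage ((n : ℝ) + 1) (by positivity) (diracProba z))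
        atTop (𝓝 μ) := by
  have hz' : ∀ ε : ℝ, 0 < ε → ∃ c : ℝ, 0 < c ∧ ∀ᶠ n : ℕ in atTop,
      c ≤ (S.timeAverage ((n : ℝ) + 1) (by positivity) (diracProba z) (Metric.ball z ε) : ℝ) := by
    intro ε hε
    obtain ⟨c, hc, hcl⟩ := exists_between (hz ε hε)
    refine ⟨c, hc, ?_⟩
    -- A real `liminf` yields eventual lower bounds only if the function is eventually bounded
    -- below.
    have hb : IsBoundedUnder (· ≥ ·) atTop fun t : ℝ => 1 / t * ∫ s in (0 : ℝ)..t,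
        (S.dual s.toNNReal (diracProba z) (Metric.ball z ε) : ℝ) := by
      refine isBoundedUnder_of_eventually_ge (a := 0) ?_
      filter_upwards [eventually_gt_atTop 0] with t ht
      rw [← S.timeAverage_apply t ht _ _ Metric.isOpen_ball.measurableSet]
      exact NNReal.coe_nonneg _
    have h := (tendsto_natCast_atTop_atTop (R := ℝ)).atTop_add (tendsto_const_nhds (x := (1 : ℝ)))
    filter_upwards [h.eventually (eventually_lt_of_lt_liminf hcl hb)] with n hn
    rw [S.timeAverage_apply _ _ _ _ Metric.isOpen_ball.measurableSet]
    exact hn.le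
  obtain ⟨μ, hμ⟩ := (S.weaklyCauchy_timeAverage z hz' fun f =>
    he f.toBoundedMeasurable f.continuous).exists_tendsto
  exact ⟨μ, S.isInvariant_of_tendsto_timeAverage z μ hμ, hμ⟩
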